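/- Let $k$ be a field, $R=k[x,y]$, and let $I=(x^d,\,y^d,\,x^by^{d-b})\subset R$, where $d,b$ are integers with $d\ge 2$, $0\le b\le d-b$ and $\gcd(d,b)=1$. Let $\mathcal R_R(I)=R[IT]=\bigoplus_{i\ge 0}I^iT^i\subset R[T]$ be the Rees algebra of $I$. Then $\mathcal R_R(I)$ is almost Cohen--Macaulay, i.e. its depth on the maximal graded ideal $\big((x,y),\,\bigoplus_{i>0}I^iT^i\big)$ (the supremum of the lengths of the $\mathcal R_R(I)$-regular sequences contained in that ideal) is at least $2$. Moreover, $\mathcal R_R(I)$ is a Cohen--Macaulay ring if and only if $d=2$. -/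

import Mathlib

/-- The depth of a commutative ring `A` on an ideal `J` (the grade of `J`): the supremum of the
lengths of the `A`-regular sequences contained in `J`. -/
noncomputable def depthOn {A : Type*} [CommRing A] (J : Ideal A) : ℕ∞ :=
  ⨆ rs ∈ {rs : List A | (∀ r ∈ rs, r ∈ J) ∧ RingTheory.Sequence.IsRegular A rs},
    (rs.length : ℕ∞)

/-- A Noetherian local ring is Cohen–Macaulay if its depth equals its Krull dimension. -/
def IsCohenMacaulayLocal (A : Type*) [CommRing A] [IsLocalRing A] : Prop :=
  IsNoetherianRing A ∧
    ((depthOn (IsLocalRing.maximalIdeal A) : ℕ∞) : WithBot ℕ∞) = ringKrullDim A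

/-- A Noetherian ring is Cohen–Macaulay if its localizations at all maximal ideals are. -/
def IsCohenMacaulay (A : Type*) [CommRing A] : Prop :=
  IsNoetherianRing A ∧
    ∀ (P : Ideal A) [P.IsMaximal], IsCohenMacaulayLocal (Localization.AtPrime P)

/-- The ideal `A₊ = ⨁_{i > 0} Iⁱ Tⁱ` of the Rees algebra `R[IT] = ⨁_{i ≥ 0} Iⁱ Tⁱ ⊆ R[T]`. -/
noncomputable def reesIrrelevant {R : Type*} [CommRing R] (I : Ideal R) :
    Ideal (reesAlgebra I) :=
  RingHom.ker ((Polynomial.constantCoeff (R := R)).comp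
    (reesAlgebra I).val.toRingHom)

/-- The maximal graded ideal `(𝔪, R[IT]₊)` of the Rees algebra of an ideal `I` of the polynomial
ring `R = k[x₁, …, xₙ]`, where `𝔪 = (x₁, …, xₙ)`. -/
noncomputable def reesGradedMaximal {k : Type*} [Field k] {n : ℕ}
    (I : Ideal (MvPolynomial (Fin n) k)) : Ideal (reesAlgebra I) :=
  Ideal.map (algebraMap (MvPolynomial (Fin n) k) (reesAlgebra I))
      (Ideal.span (Set.range MvPolynomial.X)) ⊔ reesIrrelevant I

/-- The Rees algebra of an ideal of `k[x₁, …, xₙ]` is almost Cohen–Macaulay if its depth, computed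
on the maximal graded ideal, is at least `n`. -/
def IsAlmostCohenMacaulayRees {k : Type*} [Field k] {n : ℕ}
    (I : Ideal (MvPolynomial (Fin n) k)) : Prop :=
  (n : ℕ∞) ≤ depthOn (reesGradedMaximal I)

/-- The ideal `(x^d, y^d, x^b y^(d-b))` of `k[x, y]`. -/
noncomputable def binaryMonomialIdeal (k : Type*) [Field k] (d b : ℕ) :
    Ideal (MvPolynomial (Fin 2) k) :=
  Ideal.span {MvPolynomial.X 0 ^ d, MvPolynomial.X 1 ^ d,
    MvPolynomial.X 0 ^ b * MvPolynomial.X 1 ^ (d - b)}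

/-!
Write `u, v, w` for `x^d T, x^b y^(d-b) T, y^d T`. An element `h` of the Rees algebra such that `x`
divides `u h`, `w h` and `y h` is itself divisible by `x`, so the maximal graded ideal contains a
nonzerodivisor modulo `x`, and the depth is at least `2`.

For `d > 2`, the maximal graded ideal is `(x, y, v, w) + (u)`. If the localization `A` there had
depth at least `3`, then `A / f` would have depth at least `2` for every nonzero nonunit `f`, which
forces the submodule of `A / f` killed by `x, y, v, w` to equal `u` times itself, hence to vanish.
So `f` would divide `g` in `A` as soon as it divides `xg, yg, vg, wg`. This fails for `f = x^(s+1)`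
and `g = x^(dn) y^F T^n` with `n` large, where `F` is the Frobenius number of the numerical
semigroup generated by `d` and `d - b`, and `s` is the largest element of the semigroup
below `F`.

For `d = 2`, the Rees algebra is free over the polynomial ring in `y`, `w - x`, `u`, with basis
`1, x, v`.
-/

open RingTheory.Sequence

section Depth

variable {A : Type*} [CommRing A]

theorem le_depthOn {J : Ideal A} {rs : List A} (hJ : ∀ r ∈ rs, r ∈ J) (h : IsRegular A rs) :
    (rs.length : ℕ∞) ≤ depthOn J :=
  le_iSup₂ (f := fun (rs : List A) (_ : rs ∈ {rs : List A | (∀ r ∈ rs, r ∈ J) ∧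
    IsRegular A rs}) => (rs.length : ℕ∞)) rs ⟨hJ, h⟩

theorem lt_depthOn_iff {J : Ideal A} {a : ℕ∞} :
    a < depthOn J ↔ ∃ rs : List A, (∀ r ∈ rs, r ∈ J) ∧ IsRegular A rs ∧ a < rs.length := by
  simp only [depthOn, lt_iSup_iff, Set.mem_ofPred_eq, exists_prop, and_assoc]

theorem depthOn_maximalIdeal_le_ringKrullDim [IsLocalRing A] [IsNoetherianRing A] :
    ((depthOn (IsLocalRing.maximalIdeal A) : ℕ∞) : WithBot ℕ∞) ≤ ringKrullDim A := by
  rw [← IsLocalRing.maximalIdeal_height_eq_ringKrullDim, WithBot.coe_le_coe]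
  refine iSup₂_le fun rs ⟨_, hrs⟩ => ?_
  have hne : Ideal.ofList rs ≠ ⊤ := by
    simpa only [smul_eq_mul, Ideal.mul_top] using hrs.top_ne_smul.symm
  have := Ideal.Quotient.nontrivial_iff.2 hne
  rw [← WithBot.coe_le_coe, IsLocalRing.maximalIdeal_height_eq_ringKrullDim,
    ← ringKrullDim_add_length_eq_ringKrullDim_of_isRegular rs hrs]
  exact le_add_of_nonneg_left ringKrullDim_nonneg_of_nontrivial

theorem quotSMulTop_mk_eq_zero_iff_dvd {f a : A} :
    (Submodule.Quotient.mk a : QuotSMulTop f A) = 0 ↔ f ∣ a := by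
  rw [Submodule.Quotient.mk_eq_zero, ← Submodule.ideal_span_singleton_smul, smul_eq_mul,
    Ideal.mul_top, Ideal.mem_span_singleton]

theorem two_le_depthOn [IsDomain A] [IsNoetherianRing A] {M : Ideal A} (hM : M ≠ ⊤) {u : A}
    (hu : u ∈ M) (hu0 : u ≠ 0) (hcolon : ∀ h, (∀ m ∈ M, u ∣ m * h) → u ∣ h) :
    (2 : ℕ∞) ≤ depthOn M := by
  have hhom : Subsingleton ((A ⧸ M) →ₗ[A] QuotSMulTop u A) := by
    refine subsingleton_of_forall_eq 0 fun φ => Submodule.linearMap_qext _ (LinearMap.ext_ring ?_)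
    obtain ⟨h, hh⟩ := Submodule.Quotient.mk_surjective _ (φ (Submodule.Quotient.mk 1))
    suffices u ∣ h from hh.symm.trans (quotSMulTop_mk_eq_zero_iff_dvd.2 this)
    refine hcolon h fun m hm => quotSMulTop_mk_eq_zero_iff_dvd.1 ?_
    rw [← smul_eq_mul, Submodule.Quotient.mk_smul, hh, ← map_smul, ← Submodule.Quotient.mk_smul,
      smul_eq_mul, mul_one, (Submodule.Quotient.mk_eq_zero M).2 hm, map_zero]
  obtain ⟨r, hr, hreg⟩ := IsSMulRegular.subsingleton_linearMap_iff.1 hhom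
  rw [Ideal.annihilator_quotient] at hr
  have hmem : ∀ z ∈ [u, r], z ∈ M := by simp [hu, hr]
  refine le_depthOn (rs := [u, r]) hmem ⟨?_, fun htop => hM ?_⟩
  · rw [isWeaklyRegular_cons_iff, isWeaklyRegular_singleton_iff]
    exact ⟨IsSMulRegular.of_ne_zero hu0, hreg⟩
  · rw [smul_eq_mul, Ideal.mul_top] at htop
    exact top_le_iff.1 (htop.trans_le (Ideal.span_le.2 hmem))

/- The submodule `N` killed by `Q` satisfies `N = t N`: for `n ∈ N` the elements
`s₁ n, s₂ n`, where `cᵢ ≡ sᵢ t` modulo `Q`, are the multiples `c₁ m, c₂ m` of a common `m ∈ N`,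
and `n = t m`. -/
theorem eq_zero_of_isWeaklyRegular_pair {M : Type*} [AddCommGroup M] [Module A M]
    [IsNoetherian A M] {Q : Ideal A} {t : A} (ht : t ∈ Ideal.jacobson (⊥ : Ideal A)) {c₁ c₂ : A}
    (hc₁ : c₁ ∈ Q ⊔ Ideal.span {t}) (hc₂ : c₂ ∈ Q ⊔ Ideal.span {t})
    (hreg : IsWeaklyRegular M [c₁, c₂]) {n : M} (hn : ∀ q ∈ Q, q • n = 0) : n = 0 := by
  rw [isWeaklyRegular_cons_iff, isWeaklyRegular_singleton_iff] at hreg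
  obtain ⟨hreg₁, hreg₂⟩ := hreg
  obtain ⟨s₁, q₁, hq₁, rfl⟩ := Ideal.mem_span_singleton_sup.1 (sup_comm Q _ ▸ hc₁)
  obtain ⟨s₂, q₂, hq₂, rfl⟩ := Ideal.mem_span_singleton_sup.1 (sup_comm Q _ ▸ hc₂)
  let N : Submodule A M := Submodule.torsionBySet A M Q
  have mem_N {m : M} : m ∈ N ↔ ∀ q ∈ Q, q • m = 0 := by
    simp only [N, Submodule.mem_torsionBySet_iff, Subtype.forall, SetLike.mem_coe]
  have hN : N ≤ Ideal.span {t} • N := by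
    intro n hn
    rw [mem_N] at hn
    have hswap : (s₂ * t + q₂) • s₁ • n = (s₁ * t + q₁) • s₂ • n := by
      rw [smul_smul, smul_smul, add_mul, add_mul, add_smul, add_smul, mul_comm q₁, mul_comm q₂,
        mul_smul s₁ q₂, mul_smul s₂ q₁, hn q₁ hq₁, hn q₂ hq₂]
      simp only [smul_zero, add_zero]
      ring_nf
    obtain ⟨m, hm⟩ : ∃ m, (s₁ * t + q₁) • m = s₁ • n := by
      have hzero : (s₂ * t + q₂) • (Submodule.Quotient.mk (s₁ • n) : QuotSMulTop (s₁ * t + q₁) M)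
          = 0 := by
        rw [← Submodule.Quotient.mk_smul, hswap, Submodule.Quotient.mk_eq_zero]
        exact Submodule.smul_mem_pointwise_smul _ _ _ trivial
      have := hreg₂.right_eq_zero_of_smul hzero
      rw [Submodule.Quotient.mk_eq_zero, Submodule.mem_smul_pointwise_iff_exists] at this
      simpa only [Submodule.mem_top, true_and] using this
    have hmN : m ∈ N := mem_N.2 fun q hq => hreg₁.right_eq_zero_of_smul <| by
      rw [smul_comm, hm, smul_comm, hn q hq, smul_zero]
    have hnm : n = t • m := hreg₁ <| by
      change (s₁ * t + q₁) • n = (s₁ * t + q₁) • t • m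
      rw [smul_comm _ t m, hm, add_smul, hn q₁ hq₁, add_zero, mul_comm, mul_smul]
    exact hnm ▸ Submodule.smul_mem_smul (Ideal.mem_span_singleton_self t) hmN
  have hbot : N = ⊥ := Submodule.eq_bot_of_le_smul_of_le_jacobson_bot _ N
    (IsNoetherian.noetherian N) hN ((Ideal.span_singleton_le_iff_mem _).2 ht)
  exact (Submodule.mem_bot A).1 (hbot ▸ mem_N.2 hn)

end Depth

section LocalDepth

open CategoryTheory Abelian IsLocalRing

universe u

theorem subsingleton_ext_quotSMulTop {B : Type u} [CommRing B] (N M : ModuleCat.{u} B) {f : B}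
    (hreg : IsSMulRegular M f) {i : ℕ} (h : Subsingleton (Ext N M i))
    (h' : Subsingleton (Ext N M (i + 1))) :
    Subsingleton (Ext N (ModuleCat.of B (QuotSMulTop f M)) i) :=
  AddCommGrpCat.subsingleton_of_isZero <| ShortComplex.Exact.isZero_of_both_zeros
    (Ext.covariant_sequence_exact₃' N hreg.smulShortComplex_shortExact i (i + 1) rfl)
    ((AddCommGrpCat.isZero_of_iff_subsingleton.2 h).eq_zero_of_src _)
    ((AddCommGrpCat.isZero_of_iff_subsingleton.2 h').eq_zero_of_tgt _)

variable {B : Type u} [CommRing B] [IsLocalRing B]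

theorem maximalIdeal_smul_top_lt_top (M : Type*) [AddCommGroup M] [Module B M]
    [Module.Finite B M] [Nontrivial M] : maximalIdeal B • (⊤ : Submodule B M) < ⊤ :=
  (Submodule.top_ne_ideal_smul_of_le_jacobson_annihilator (maximalIdeal_le_jacobson _)).symm.lt_top

variable [IsNoetherianRing B]

theorem subsingleton_ext_residue_of_lt_depthOn {n : ℕ}
    (hn : (n : ℕ∞) < depthOn (maximalIdeal B)) {i : ℕ} (hi : i ≤ n) :
    Subsingleton (Ext (ModuleCat.of B (B ⧸ maximalIdeal B)) (ModuleCat.of B B) i) := by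
  obtain ⟨rs, hmem, hreg, hlen⟩ := lt_depthOn_iff.1 hn
  refine ModuleCat.subsingleton_ext_of_exists_isRegular (maximalIdeal B)
    (ModuleCat.of B (B ⧸ maximalIdeal B)) ?_ (ModuleCat.of B B)
    (maximalIdeal_smul_top_lt_top B) rs hmem hreg i (hi.trans_lt (by exact_mod_cast hlen))
  rw [Module.support_eq_zeroLocus, Ideal.annihilator_quotient]

theorem exists_isRegular_quotSMulTop {f : B} (hf : f ∈ maximalIdeal B) (hreg : IsSMulRegular B f)
    {n : ℕ} (hn : (n : ℕ∞) < depthOn (maximalIdeal B)) :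
    ∃ rs : List B, rs.length = n ∧ (∀ r ∈ rs, r ∈ maximalIdeal B) ∧
      IsRegular (QuotSMulTop f B) rs := by
  have : Nontrivial (QuotSMulTop f B) := by
    refine Submodule.Quotient.nontrivial_iff.2 fun h => ?_
    rw [← Submodule.ideal_span_singleton_smul, smul_eq_mul, Ideal.mul_top] at h
    exact (maximalIdeal.isMaximal B).ne_top
      (top_le_iff.1 (h ▸ (Ideal.span_singleton_le_iff_mem _).2 hf))
  have hsupp : Module.support B (ModuleCat.of B (B ⧸ maximalIdeal B)) =
      PrimeSpectrum.zeroLocus (maximalIdeal B) := by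
    rw [Module.support_eq_zeroLocus, Ideal.annihilator_quotient]
  exact ModuleCat.exists_isRegular_of_exists_subsingleton_ext (maximalIdeal B) n
    (ModuleCat.of B (QuotSMulTop f B)) (maximalIdeal_smul_top_lt_top (QuotSMulTop f B))
    (ModuleCat.of B (B ⧸ maximalIdeal B)) hsupp
    fun i hi => subsingleton_ext_quotSMulTop _ (ModuleCat.of B B) hreg
      (subsingleton_ext_residue_of_lt_depthOn hn hi.le)
      (subsingleton_ext_residue_of_lt_depthOn hn hi)

theorem dvd_of_forall_mem_dvd_mul_of_two_lt_depthOn {Q : Ideal B} {t : B}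
    (hQ : maximalIdeal B = Q ⊔ Ideal.span {t}) (hdepth : 2 < depthOn (maximalIdeal B)) {f g : B}
    (hf : IsSMulRegular B f) (hfg : ∀ q ∈ Q, f ∣ q * g) : f ∣ g := by
  by_cases hfm : f ∈ maximalIdeal B
  swap
  · exact (notMem_maximalIdeal.1 hfm).dvd
  obtain ⟨rs, hlen, hmem, hreg⟩ := exists_isRegular_quotSMulTop hfm hf (n := 2) hdepth
  obtain ⟨c₁, c₂, rfl⟩ := List.length_eq_two.1 hlen
  have ht : t ∈ Ideal.jacobson (⊥ : Ideal B) :=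
    maximalIdeal_le_jacobson _ (hQ ▸ Ideal.mem_sup_right (Ideal.mem_span_singleton_self t))
  refine quotSMulTop_mk_eq_zero_iff_dvd.1 <| eq_zero_of_isWeaklyRegular_pair ht
    (hQ ▸ hmem c₁ (by simp)) (hQ ▸ hmem c₂ (by simp)) hreg.toIsWeaklyRegular fun q hq => ?_
  rw [← Submodule.Quotient.mk_smul, quotSMulTop_mk_eq_zero_iff_dvd]
  exact hfg q hq

end LocalDepth

theorem dvd_mul_of_mem_span {A : Type*} [CommRing A] {s : Set A} {f g : A}
    (h : ∀ q ∈ s, f ∣ q * g) {q : A} (hq : q ∈ Ideal.span s) : f ∣ q * g := by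
  have hle : Ideal.span s ≤ (Ideal.span {f}).colon {g} :=
    Ideal.span_le.2 fun r hr => by
      simpa only [SetLike.mem_coe, Submodule.mem_colon_singleton, smul_eq_mul,
        Ideal.mem_span_singleton] using h r hr
  simpa only [Submodule.mem_colon_singleton, smul_eq_mul, Ideal.mem_span_singleton] using hle hq

theorem exists_notMem_dvd_mul_of_two_lt_depthOn {A : Type*} [CommRing A] [IsDomain A]
    [IsNoetherianRing A] {M : Ideal A} [M.IsMaximal] {s : Set A} {t : A}
    (hM : M = Ideal.span s ⊔ Ideal.span {t})
    (hdepth : 2 < depthOn (IsLocalRing.maximalIdeal (Localization.AtPrime M))) {f g : A}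
    (hf : f ≠ 0) (hfg : ∀ q ∈ s, f ∣ q * g) : ∃ σ ∉ M, f ∣ σ * g := by
  let ι := algebraMap A (Localization.AtPrime M)
  have hι : Function.Injective ι := FaithfulSMul.algebraMap_injective _ _
  have hmax : IsLocalRing.maximalIdeal (Localization.AtPrime M) =
      Ideal.span (ι '' s) ⊔ Ideal.span {ι t} := by
    rw [← Localization.AtPrime.map_eq_maximalIdeal]
    refine (congrArg (Ideal.map ι) hM).trans ?_
    rw [Ideal.map_sup, Ideal.map_span, Ideal.map_span, Set.image_singleton]
  obtain ⟨c, hc⟩ : ι f ∣ ι g := by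
    refine dvd_of_forall_mem_dvd_mul_of_two_lt_depthOn hmax hdepth
      (.of_ne_zero ((map_ne_zero_iff ι hι).2 hf)) fun q hq => dvd_mul_of_mem_span ?_ hq
    rintro _ ⟨r, hr, rfl⟩
    rw [← map_mul]
    exact map_dvd ι (hfg r hr)
  obtain ⟨⟨a, σ⟩, hσ⟩ := IsLocalization.surj M.primeCompl c
  refine ⟨σ, σ.2, a, hι ?_⟩
  calc ι (σ * g) = ι f * (c * ι σ) := by rw [map_mul, hc]; ring
    _ = ι (f * a) := by rw [map_mul, hσ]

section Monomials

open scoped Pointwise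

theorem triple_pow {R : Type*} [CommMonoid R] (a b c : R) (n : ℕ) :
    ({a, b, c} : Set R) ^ n = {z | ∃ i j l, i + j + l = n ∧ a ^ i * b ^ j * c ^ l = z} := by
  refine subset_antisymm (fun z hz => ?_) ?_
  · induction n generalizing z with
    | zero => exact ⟨0, 0, 0, rfl, by simpa [eq_comm] using hz⟩
    | succ n ih =>
      obtain ⟨_, hz', m, hm, rfl⟩ := Set.mem_mul.1 (pow_succ ({a, b, c} : Set R) n ▸ hz)
      obtain ⟨i, j, l, rfl, rfl⟩ := ih _ hz'
      rcases hm with rfl | rfl | rfl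
      · exact ⟨i + 1, j, l, by ring, by simp only [pow_succ]; ac_rfl⟩
      · exact ⟨i, j + 1, l, by ring, by simp only [pow_succ]; ac_rfl⟩
      · exact ⟨i, j, l + 1, by ring, by simp only [pow_succ]; ac_rfl⟩
  · rintro _ ⟨i, j, l, rfl, rfl⟩
    rw [pow_add, pow_add]
    exact Set.mul_mem_mul (Set.mul_mem_mul (Set.pow_mem_pow (by simp)) (Set.pow_mem_pow (by simp)))
      (Set.pow_mem_pow (by simp))

variable {k : Type*} [Field k] {d b : ℕ}

theorem X_pow_mul_X_pow_eq_monomial (i j : ℕ) :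
    (MvPolynomial.X 0 ^ i * MvPolynomial.X 1 ^ j : MvPolynomial (Fin 2) k) =
      MvPolynomial.monomial (Finsupp.single 0 i + Finsupp.single 1 j) 1 := by
  rw [MvPolynomial.X_pow_eq_monomial, MvPolynomial.X_pow_eq_monomial, MvPolynomial.monomial_mul,
    one_mul]

theorem binaryMonomialIdeal_pow (n : ℕ) : binaryMonomialIdeal k d b ^ n =
    Ideal.span ((fun m => MvPolynomial.monomial m (1 : k)) '' {m | ∃ α β γ, α + β + γ = n ∧
      Finsupp.single 0 (d * α + b * γ) + Finsupp.single 1 (d * β + (d - b) * γ) = m}) := by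
  rw [binaryMonomialIdeal, Ideal.span, Submodule.span_pow, triple_pow]
  congr 1
  ext p
  constructor
  · rintro ⟨α, β, γ, h, rfl⟩
    refine ⟨_, ⟨α, β, γ, h, rfl⟩, ?_⟩
    simp only [← X_pow_mul_X_pow_eq_monomial]
    ring
  · rintro ⟨_, ⟨α, β, γ, h, rfl⟩, rfl⟩
    refine ⟨α, β, γ, h, ?_⟩
    simp only [← X_pow_mul_X_pow_eq_monomial]
    ring

theorem single_add_single_le_iff {i j : ℕ} {m : Fin 2 →₀ ℕ} :
    Finsupp.single 0 i + Finsupp.single 1 j ≤ m ↔ i ≤ m 0 ∧ j ≤ m 1 := by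
  simp [Finsupp.le_def, Fin.forall_fin_two]

theorem mem_binaryMonomialIdeal_pow (hb : b ≤ d) {n : ℕ} {p : MvPolynomial (Fin 2) k} :
    p ∈ binaryMonomialIdeal k d b ^ n ↔ ∀ m ∈ p.support, ∃ β γ, β + γ ≤ n ∧
      d * β + (d - b) * γ ≤ m 1 ∧ d * n ≤ m 0 + (d * β + (d - b) * γ) := by
  obtain ⟨e, rfl⟩ := Nat.exists_eq_add_of_le hb
  rw [binaryMonomialIdeal_pow, MvPolynomial.mem_ideal_span_monomial_image]
  refine forall₂_congr fun m _ => ⟨?_, ?_⟩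
  · rintro ⟨_, ⟨α, β, γ, rfl, rfl⟩, hm⟩
    obtain ⟨h₀, h₁⟩ := single_add_single_le_iff.1 hm
    rw [Nat.add_sub_cancel_left] at h₁ ⊢
    exact ⟨β, γ, by omega, h₁, by linarith⟩
  · rintro ⟨β, γ, hn, h₁, h₀⟩
    obtain ⟨α, rfl⟩ := Nat.exists_eq_add_of_le hn
    rw [Nat.add_sub_cancel_left] at h₁ h₀
    refine ⟨_, ⟨α, β, γ, by ring, rfl⟩, single_add_single_le_iff.2 ⟨by linarith, ?_⟩⟩
    rwa [Nat.add_sub_cancel_left]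

theorem X_pow_mul_X_pow_mem_pow (hb : b ≤ d) {n i j : ℕ} :
    (MvPolynomial.X 0 ^ i * MvPolynomial.X 1 ^ j : MvPolynomial (Fin 2) k) ∈
      binaryMonomialIdeal k d b ^ n ↔ ∃ β γ, β + γ ≤ n ∧
        d * β + (d - b) * γ ≤ j ∧ d * n ≤ i + (d * β + (d - b) * γ) := by
  classical
  rw [mem_binaryMonomialIdeal_pow hb, X_pow_mul_X_pow_eq_monomial, MvPolynomial.support_monomial,
    if_neg one_ne_zero]
  simp

theorem X_pow_mul_X_pow_mem_pow_iff_exists_mem_closure (hb : b < d) {n i j : ℕ} (hj : j ≤ n) :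
    (MvPolynomial.X 0 ^ i * MvPolynomial.X 1 ^ j : MvPolynomial (Fin 2) k) ∈
      binaryMonomialIdeal k d b ^ n ↔
        ∃ t ∈ AddSubmonoid.closure {d, d - b}, t ≤ j ∧ d * n ≤ i + t := by
  simp only [X_pow_mul_X_pow_mem_pow hb.le, AddSubmonoid.mem_closure_pair, smul_eq_mul]
  constructor
  · rintro ⟨β, γ, -, h₁, h₀⟩
    exact ⟨_, ⟨β, γ, by ring⟩, h₁, h₀⟩
  · rintro ⟨_, ⟨β, γ, rfl⟩, h₁, h₀⟩
    rw [mul_comm β, mul_comm γ] at h₁ h₀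
    refine ⟨β, γ, ?_, h₁, h₀⟩
    have hβ : β ≤ d * β := Nat.le_mul_of_pos_left β (by omega)
    have hγ : γ ≤ (d - b) * γ := Nat.le_mul_of_pos_left γ (by omega)
    omega

theorem mem_pow_of_mul_mem_pow_succ (hb : b ≤ d) {n : ℕ} {p : MvPolynomial (Fin 2) k}
    (hx : MvPolynomial.X 0 ^ d * p ∈ binaryMonomialIdeal k d b ^ (n + 1))
    (hy : MvPolynomial.X 1 ^ d * p ∈ binaryMonomialIdeal k d b ^ (n + 1)) :
    p ∈ binaryMonomialIdeal k d b ^ n := by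
  rw [mem_binaryMonomialIdeal_pow hb] at hx hy ⊢
  intro m hm
  have mem_support (i : Fin 2) :
      Finsupp.single i d + m ∈ (MvPolynomial.X i ^ d * p).support := by
    rwa [MvPolynomial.mem_support_iff, MvPolynomial.X_pow_eq_monomial,
      MvPolynomial.coeff_monomial_mul, one_mul, ← MvPolynomial.mem_support_iff]
  obtain ⟨β, γ, hn, h₁, h₀⟩ := hx _ (mem_support 0)
  obtain ⟨β', γ', hn', h₁', h₀'⟩ := hy _ (mem_support 1)
  have he : d - b ≤ d := d.sub_le b
  simp only [Finsupp.coe_add, Pi.add_apply, Finsupp.single_eq_same, ne_eq, zero_ne_one,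
    one_ne_zero, not_false_eq_true, Finsupp.single_eq_of_ne, zero_add] at h₁ h₀ h₁' h₀'
  generalize d - b = e at *
  rcases Nat.le_or_eq_of_le_succ hn with hn | hn
  · exact ⟨β, γ, hn, h₁, by linarith⟩
  rcases β' with _ | β'
  · -- Neither witness has a pure power to discard, so `(x^b y^(d-b))^n` divides the monomial `m`.
    refine ⟨0, n, by omega, ?_, ?_⟩
    · nlinarith
    · nlinarith
  · exact ⟨β', γ', by omega, by linarith, by linarith⟩

theorem mem_pow_of_mul_mem_pow (hb : b ≤ d) {n i j : ℕ} {s : MvPolynomial (Fin 2) k}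
    (hs : MvPolynomial.constantCoeff s ≠ 0)
    (h : s * (MvPolynomial.X 0 ^ i * MvPolynomial.X 1 ^ j) ∈ binaryMonomialIdeal k d b ^ n) :
    (MvPolynomial.X 0 ^ i * MvPolynomial.X 1 ^ j : MvPolynomial (Fin 2) k) ∈
      binaryMonomialIdeal k d b ^ n := by
  rw [X_pow_mul_X_pow_mem_pow hb]
  rw [mem_binaryMonomialIdeal_pow hb] at h
  have hmem : Finsupp.single 0 i + Finsupp.single 1 j ∈
      (s * (MvPolynomial.X 0 ^ i * MvPolynomial.X 1 ^ j)).support := by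
    rw [MvPolynomial.mem_support_iff, X_pow_mul_X_pow_eq_monomial,
      MvPolynomial.coeff_mul_monomial', if_pos le_rfl, mul_one, tsub_self]
    exact hs
  simpa using h _ hmem

end Monomials

section ReesAlgebra

variable {R : Type*} [CommRing R]

theorem ker_eq_span_of_adjoin_eq_top {A : Type*} [CommRing A] [Algebra R A] (ε : A →ₐ[R] R)
    {s : Set A} (hs : Algebra.adjoin R s = ⊤) (hε : ∀ a ∈ s, ε a = 0) :
    RingHom.ker ε = Ideal.span s := by
  refine le_antisymm (fun a ha => ?_) (Ideal.span_le.2 hε)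
  have hmk : Ideal.Quotient.mkₐ R (Ideal.span s) =
      (Algebra.ofId R (A ⧸ Ideal.span s)).comp ε := by
    refine AlgHom.ext_of_adjoin_eq_top hs fun x hx => ?_
    rw [AlgHom.comp_apply, hε x hx, map_zero]
    exact Ideal.Quotient.eq_zero_iff_mem.2 (Ideal.subset_span hx)
  rw [← Ideal.Quotient.eq_zero_iff_mem, ← Ideal.Quotient.mkₐ_eq_mk R, hmk, AlgHom.comp_apply,
    RingHom.mem_ker.1 ha, map_zero]

theorem adjoin_reesAlgebra_span (s : Set R) : Algebra.adjoin R
    (Subtype.val ⁻¹' (Polynomial.monomial 1 '' s) : Set (reesAlgebra (Ideal.span s))) = ⊤ := by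
  have himage : (reesAlgebra (Ideal.span s)).val '' (Subtype.val ⁻¹' (Polynomial.monomial 1 '' s)) =
      Polynomial.monomial 1 '' s := by
    refine Set.image_preimage_eq_of_subset (f := Subtype.val) ?_
    rw [Subtype.range_val]
    rintro _ ⟨r, hr, rfl⟩
    exact reesAlgebra.monomial_mem.2 ((pow_one (Ideal.span s)).symm ▸ Ideal.subset_span hr)
  apply Subalgebra.map_injective (f := (reesAlgebra (Ideal.span s)).val) Subtype.val_injective
  rw [AlgHom.map_adjoin, himage, Algebra.map_top, Subalgebra.range_val,
    ← adjoin_monomial_eq_reesAlgebra, ← Ideal.submodule_span_eq, Submodule.map_span,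
    Algebra.adjoin_span]

/-- The projection of the Rees algebra onto its component of degree zero, whose kernel is
`reesIrrelevant I`. -/
noncomputable def reesAugmentation (I : Ideal R) : reesAlgebra I →ₐ[R] R :=
  (Polynomial.aeval 0).comp (reesAlgebra I).val

theorem reesAugmentation_apply {I : Ideal R} (a : reesAlgebra I) :
    reesAugmentation I a = (a : Polynomial R).coeff 0 :=
  (Polynomial.coeff_zero_eq_aeval_zero _).symm

theorem ker_reesAugmentation (I : Ideal R) :
    RingHom.ker (reesAugmentation I) = reesIrrelevant I := by
  ext a
  rw [RingHom.mem_ker, reesAugmentation_apply]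
  rfl

theorem reesIrrelevant_span (s : Set R) : reesIrrelevant (Ideal.span s) =
    Ideal.span (Subtype.val ⁻¹' (Polynomial.monomial 1 '' s)) := by
  rw [← ker_reesAugmentation]
  refine ker_eq_span_of_adjoin_eq_top _ (adjoin_reesAlgebra_span s) fun a ha => ?_
  obtain ⟨r, -, hr⟩ := ha
  rw [reesAugmentation_apply, ← hr, Polynomial.coeff_monomial_of_ne _ zero_ne_one]

theorem reesAugmentation_surjective (I : Ideal R) : Function.Surjective (reesAugmentation I) :=
  fun r => ⟨algebraMap _ _ r, (reesAugmentation I).commutes r⟩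

theorem map_algebraMap_sup_reesIrrelevant (I J : Ideal R) :
    J.map (algebraMap R (reesAlgebra I)) ⊔ reesIrrelevant I = J.comap (reesAugmentation I) := by
  have hcomp : (reesAugmentation I : reesAlgebra I →+* R).comp (algebraMap R _) = RingHom.id R :=
    (reesAugmentation I).comp_algebraMap
  have hmap : (J.map (algebraMap R (reesAlgebra I))).map (reesAugmentation I) = J :=
    (Ideal.map_map _ (reesAugmentation I : reesAlgebra I →+* R)).trans (hcomp ▸ Ideal.map_id J)
  rw [← ker_reesAugmentation,
    ← Ideal.comap_map_of_surjective' _ (reesAugmentation_surjective I), hmap]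

theorem algebraMap_dvd_iff {I : Ideal R} {r : R} {a : reesAlgebra I} :
    algebraMap R (reesAlgebra I) r ∣ a ↔
      ∀ n, ∃ q ∈ I ^ n, r * q = (a : Polynomial R).coeff n := by
  constructor
  · rintro ⟨c, rfl⟩ n
    exact ⟨_, c.2 n, (Polynomial.coeff_C_mul _).symm⟩
  · intro h
    choose q hq hrq using h
    let c : Polynomial R := ∑ n ∈ (a : Polynomial R).support, Polynomial.monomial n (q n)
    have hc : c ∈ reesAlgebra I := sum_mem fun n _ => reesAlgebra.monomial_mem.2 (hq n)
    refine ⟨⟨c, hc⟩, Subtype.ext ?_⟩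
    change (a : Polynomial R) = Polynomial.C r * c
    simp only [c, Finset.mul_sum, Polynomial.C_mul_monomial, hrq]
    exact Polynomial.as_sum_support _

end ReesAlgebra

section GradedMaximal

variable {k : Type*} [Field k] {n : ℕ} {I : Ideal (MvPolynomial (Fin n) k)}

theorem ker_constantCoeff_eq_span_range_X (σ R : Type*) [CommRing R] :
    RingHom.ker (MvPolynomial.constantCoeff (σ := σ) (R := R)) =
      Ideal.span (Set.range MvPolynomial.X) := by
  have h := ker_eq_span_of_adjoin_eq_top (MvPolynomial.aeval (0 : σ → R))
    MvPolynomial.adjoin_range_X (by rintro _ ⟨i, rfl⟩; simp)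
  rw [← h]
  ext p
  simp [RingHom.mem_ker]

theorem reesGradedMaximal_eq_comap (I : Ideal (MvPolynomial (Fin n) k)) : reesGradedMaximal I =
    (RingHom.ker MvPolynomial.constantCoeff).comap (reesAugmentation I) := by
  rw [reesGradedMaximal, map_algebraMap_sup_reesIrrelevant, ker_constantCoeff_eq_span_range_X]

theorem mem_reesGradedMaximal {a : reesAlgebra I} : a ∈ reesGradedMaximal I ↔
    MvPolynomial.constantCoeff ((a : Polynomial (MvPolynomial (Fin n) k)).coeff 0) = 0 := by
  rw [reesGradedMaximal_eq_comap, Ideal.mem_comap, RingHom.mem_ker, reesAugmentation_apply]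

instance : (reesGradedMaximal I).IsMaximal := by
  have : (RingHom.ker (MvPolynomial.constantCoeff (σ := Fin n) (R := k))).IsMaximal :=
    RingHom.ker_isMaximal_of_surjective _ fun c => ⟨_, MvPolynomial.constantCoeff_C _ c⟩
  rw [reesGradedMaximal_eq_comap]
  exact Ideal.comap_isMaximal_of_surjective _ (reesAugmentation_surjective I)

theorem three_le_height_reesGradedMaximal {I : Ideal (MvPolynomial (Fin 2) k)} (hI : I ≠ ⊥) :
    3 ≤ (reesGradedMaximal I).height := by
  have : (Ideal.span {(MvPolynomial.X 0 : MvPolynomial (Fin 2) k)}).IsPrime :=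
    (Ideal.span_singleton_prime (MvPolynomial.X_ne_zero 0)).2 MvPolynomial.X_prime
  have hmono : StrictMono (Ideal.comap (reesAugmentation I)) :=
    (Ideal.orderEmbeddingOfSurjective _ (reesAugmentation_surjective I)).strictMono
  let P₁ := (⊥ : Ideal (MvPolynomial (Fin 2) k)).comap (reesAugmentation I)
  let P₂ := (Ideal.span {(MvPolynomial.X 0 : MvPolynomial (Fin 2) k)}).comap (reesAugmentation I)
  have h₁ : ⊥ < P₁ := by
    obtain ⟨r, hr, hr0⟩ := Submodule.exists_mem_ne_zero_of_ne_bot hI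
    refine bot_lt_iff_ne_bot.2 ((Submodule.ne_bot_iff _).2
      ⟨⟨Polynomial.monomial 1 r, reesAlgebra.monomial_mem.2 ((pow_one I).symm ▸ hr)⟩, ?_, ?_⟩)
    · rw [Ideal.mem_comap, reesAugmentation_apply, Polynomial.coeff_monomial_of_ne _ zero_ne_one]
      exact zero_mem _
    · exact fun h => hr0 ((Polynomial.monomial_eq_zero_iff r 1).1 (congrArg Subtype.val h))
  have h₂ : P₁ < P₂ := hmono <| bot_lt_iff_ne_bot.2 fun h =>
    MvPolynomial.X_ne_zero 0 (Ideal.span_singleton_eq_bot.1 h)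
  have h₃ : P₂ < reesGradedMaximal I := by
    rw [reesGradedMaximal_eq_comap]
    refine hmono (SetLike.lt_iff_le_and_exists.2 ⟨?_, MvPolynomial.X 1, ?_, fun h => ?_⟩)
    · exact (Ideal.span_singleton_le_iff_mem _).2 (MvPolynomial.constantCoeff_X k 0)
    · exact MvPolynomial.constantCoeff_X k 1
    · simp [MvPolynomial.X_dvd_X, Ideal.mem_span_singleton] at h
  calc (3 : ℕ∞) ≤ (⊥ : Ideal (reesAlgebra I)).height + 1 + 1 + 1 := by
        rw [add_assoc, add_assoc]
        exact le_add_self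
    _ ≤ P₁.height + 1 + 1 := by gcongr; exact Ideal.height_add_one_le_of_lt_of_isPrime h₁
    _ ≤ P₂.height + 1 := by gcongr; exact Ideal.height_add_one_le_of_lt_of_isPrime h₂
    _ ≤ (reesGradedMaximal I).height := Ideal.height_add_one_le_of_lt_of_isPrime h₃

end GradedMaximal

theorem range_fin_two {α : Type*} (f : Fin 2 → α) : Set.range f = {f 0, f 1} := by
  ext a
  simp [Fin.exists_fin_two, eq_comm]

/-- The Rees algebra of `(x^d, y^d, x^b y^(d-b))`. -/
abbrev BinaryRees (k : Type*) [Field k] (d b : ℕ) : Type _ :=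
  reesAlgebra (binaryMonomialIdeal k d b)

namespace BinaryRees

section Generators

variable (k : Type*) [Field k] (d b : ℕ)

/-- The element `x` of degree zero. -/
noncomputable def x : BinaryRees k d b :=
  algebraMap (MvPolynomial (Fin 2) k) _ (MvPolynomial.X 0)

/-- The element `y` of degree zero. -/
noncomputable def y : BinaryRees k d b :=
  algebraMap (MvPolynomial (Fin 2) k) _ (MvPolynomial.X 1)

variable {k d b} in
/-- The monomial `x^i y^j T^n`. -/
noncomputable def mono {n i j : ℕ} (h : (MvPolynomial.X 0 ^ i * MvPolynomial.X 1 ^ j :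
    MvPolynomial (Fin 2) k) ∈ binaryMonomialIdeal k d b ^ n) : BinaryRees k d b :=
  ⟨Polynomial.C (MvPolynomial.X 0) ^ i * Polynomial.C (MvPolynomial.X 1) ^ j * Polynomial.X ^ n,
    by simpa [← Polynomial.C_mul_X_pow_eq_monomial] using reesAlgebra.monomial_mem.2 h⟩

/-- The element `x^d T`. -/
noncomputable def u : BinaryRees k d b :=
  ⟨Polynomial.monomial 1 (MvPolynomial.X 0 ^ d),
    reesAlgebra.monomial_mem.2 (by rw [pow_one]; exact Ideal.subset_span (by simp))⟩

/-- The element `x^b y^(d-b) T`. -/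
noncomputable def v : BinaryRees k d b :=
  ⟨Polynomial.monomial 1 (MvPolynomial.X 0 ^ b * MvPolynomial.X 1 ^ (d - b)),
    reesAlgebra.monomial_mem.2 (by rw [pow_one]; exact Ideal.subset_span (by simp))⟩

/-- The element `y^d T`. -/
noncomputable def w : BinaryRees k d b :=
  ⟨Polynomial.monomial 1 (MvPolynomial.X 1 ^ d),
    reesAlgebra.monomial_mem.2 (by rw [pow_one]; exact Ideal.subset_span (by simp))⟩

variable {k d b}

theorem coe_x : (x k d b : Polynomial (MvPolynomial (Fin 2) k)) =
    Polynomial.C (MvPolynomial.X 0) := rfl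

theorem x_ne_zero : x k d b ≠ 0 := fun h =>
  Polynomial.C_ne_zero.2 (MvPolynomial.X_ne_zero 0) (congrArg Subtype.val h)

theorem coe_y : (y k d b : Polynomial (MvPolynomial (Fin 2) k)) =
    Polynomial.C (MvPolynomial.X 1) := rfl

theorem coe_u : (u k d b : Polynomial (MvPolynomial (Fin 2) k)) =
    Polynomial.C (MvPolynomial.X 0) ^ d * Polynomial.X := by
  rw [← map_pow, Polynomial.C_mul_X_eq_monomial, u]

theorem coe_v : (v k d b : Polynomial (MvPolynomial (Fin 2) k)) =
    Polynomial.C (MvPolynomial.X 0) ^ b * Polynomial.C (MvPolynomial.X 1) ^ (d - b) *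
      Polynomial.X := by
  rw [← map_pow, ← map_pow, ← map_mul, Polynomial.C_mul_X_eq_monomial, v]

theorem coe_w : (w k d b : Polynomial (MvPolynomial (Fin 2) k)) =
    Polynomial.C (MvPolynomial.X 1) ^ d * Polynomial.X := by
  rw [← map_pow, Polynomial.C_mul_X_eq_monomial, w]

theorem preimage_monomial_one_image : (Subtype.val ⁻¹' (Polynomial.monomial 1 ''
    {MvPolynomial.X 0 ^ d, MvPolynomial.X 1 ^ d,
      MvPolynomial.X 0 ^ b * MvPolynomial.X 1 ^ (d - b)}) : Set (BinaryRees k d b)) =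
    {u k d b, w k d b, v k d b} := by
  ext a
  simp only [Set.image_insert_eq, Set.image_singleton, Set.mem_preimage, Set.mem_insert_iff,
    Set.mem_singleton_iff, Subtype.ext_iff, u, v, w]

theorem adjoin_generators_eq_top :
    Algebra.adjoin k {x k d b, y k d b, u k d b, w k d b, v k d b} = ⊤ := by
  have hR : Algebra.adjoin (MvPolynomial (Fin 2) k) {u k d b, w k d b, v k d b} = ⊤ :=
    preimage_monomial_one_image (k := k) (d := d) (b := b) ▸ adjoin_reesAlgebra_span _
  have hset : ({x k d b, y k d b, u k d b, w k d b, v k d b} : Set (BinaryRees k d b)) =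
      algebraMap (MvPolynomial (Fin 2) k) _ '' Set.range MvPolynomial.X ∪
        {u k d b, w k d b, v k d b} := by
    rw [range_fin_two, Set.image_pair, Set.insert_union, Set.singleton_union]
    rfl
  rw [hset, Algebra.adjoin_algebraMap_image_union_eq_adjoin_adjoin, MvPolynomial.adjoin_range_X,
    Algebra.adjoin_top, hR, Subalgebra.restrictScalars_top, Subalgebra.restrictScalars_top]

theorem reesGradedMaximal_eq_span : reesGradedMaximal (binaryMonomialIdeal k d b) =
    Ideal.span {x k d b, y k d b, v k d b, w k d b} ⊔ Ideal.span {u k d b} := by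
  have hirr : reesIrrelevant (binaryMonomialIdeal k d b) = Ideal.span {u k d b, w k d b, v k d b} :=
    (reesIrrelevant_span _).trans (congrArg _ preimage_monomial_one_image)
  rw [reesGradedMaximal, hirr, Ideal.map_span, range_fin_two, Set.image_pair, ← Ideal.span_union,
    ← Ideal.span_union]
  congr 1
  change {x k d b, y k d b} ∪ _ = _
  ext a
  simp only [Set.mem_union, Set.mem_insert_iff, Set.mem_singleton_iff]
  tauto

end Generators

section Depth

variable {k : Type*} [Field k] {d b : ℕ}

theorem x_dvd_of_forall_dvd (hb : b ≤ d) {h : BinaryRees k d b} (hu : x k d b ∣ u k d b * h)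
    (hw : x k d b ∣ w k d b * h) (hy : x k d b ∣ y k d b * h) : x k d b ∣ h := by
  refine algebraMap_dvd_iff.2 fun n => ?_
  obtain ⟨p, -, hp⟩ := algebraMap_dvd_iff.1 hy n
  rw [MulMemClass.coe_mul, coe_y, Polynomial.coeff_C_mul] at hp
  obtain ⟨q, hq⟩ : MvPolynomial.X 0 ∣ (h : Polynomial (MvPolynomial (Fin 2) k)).coeff n :=
    (MvPolynomial.X_dvd_mul_iff.1 ⟨_, hp.symm⟩).resolve_left (by simp [MvPolynomial.X_dvd_X])
  have hmem {r : MvPolynomial (Fin 2) k}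
      (hr : Polynomial.monomial 1 r ∈ reesAlgebra (binaryMonomialIdeal k d b))
      (hdvd : x k d b ∣ ⟨_, hr⟩ * h) : r * q ∈ binaryMonomialIdeal k d b ^ (n + 1) := by
    obtain ⟨q', hq', heq⟩ := algebraMap_dvd_iff.1 hdvd (n + 1)
    rw [MulMemClass.coe_mul, Polynomial.coeff_monomial_mul, hq, mul_left_comm] at heq
    exact mul_left_cancel₀ (MvPolynomial.X_ne_zero 0) heq ▸ hq'
  exact ⟨q, mem_pow_of_mul_mem_pow_succ hb (hmem _ hu) (hmem _ hw), hq.symm⟩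

theorem isAlmostCohenMacaulayRees (hb : b ≤ d) :
    IsAlmostCohenMacaulayRees (binaryMonomialIdeal k d b) := by
  have hM := reesGradedMaximal_eq_span (k := k) (d := d) (b := b)
  have hmem {z} (hz : z ∈ ({x k d b, y k d b, v k d b, w k d b} : Set (BinaryRees k d b))) :
      z ∈ reesGradedMaximal (binaryMonomialIdeal k d b) :=
    hM ▸ Ideal.mem_sup_left (Ideal.subset_span hz)
  have hu : u k d b ∈ reesGradedMaximal (binaryMonomialIdeal k d b) :=
    hM ▸ Ideal.mem_sup_right (Ideal.mem_span_singleton_self _)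
  exact two_le_depthOn (Ideal.IsMaximal.ne_top inferInstance) (hmem (by simp)) x_ne_zero
    fun h hh => x_dvd_of_forall_dvd hb (hh _ hu) (hh _ (hmem (by simp))) (hh _ (hmem (by simp)))

end Depth

end BinaryRees

theorem exists_gap_closure_pair {m n : ℕ} (hcop : m.Coprime n) (hm : 1 < m) (hn : 1 < n) :
    ∃ F, ∃ s ∈ AddSubmonoid.closure {m, n}, s < F ∧
      (∀ t ∈ AddSubmonoid.closure {m, n}, t ≤ F → t ≤ s) ∧
      ∀ t > F, t ∈ AddSubmonoid.closure {m, n} := by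
  obtain ⟨hF, hlarge⟩ := frobeniusNumber_iff.1 (frobeniusNumber_pair hcop hm hn)
  generalize m * n - m - n = F at hF hlarge
  obtain ⟨s, ⟨hs, hsF⟩, hmax⟩ := BddAbove.exists_isGreatest_of_nonempty
    (S := {s | s ∈ AddSubmonoid.closure {m, n} ∧ s ≤ F}) ⟨F, fun _ h => h.2⟩
    ⟨0, zero_mem _, F.zero_le⟩
  exact ⟨F, s, hs, hsF.lt_of_ne (by rintro rfl; exact hF hs),
    fun t ht htF => hmax ⟨ht, htF⟩, hlarge⟩

namespace BinaryRees

section NotCohenMacaulay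

variable {k : Type*} [Field k] {d b : ℕ}

theorem coe_mono {n i j : ℕ} (h : (MvPolynomial.X 0 ^ i * MvPolynomial.X 1 ^ j :
    MvPolynomial (Fin 2) k) ∈ binaryMonomialIdeal k d b ^ n) :
    (mono h : Polynomial (MvPolynomial (Fin 2) k)) =
      Polynomial.C (MvPolynomial.X 0) ^ i * Polynomial.C (MvPolynomial.X 1) ^ j *
        Polynomial.X ^ n := rfl

theorem mem_pow_of_x_pow_dvd_mul_mono (hb : b ≤ d) {p n i j : ℕ}
    (h : (MvPolynomial.X 0 ^ (p + i) * MvPolynomial.X 1 ^ j : MvPolynomial (Fin 2) k) ∈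
      binaryMonomialIdeal k d b ^ n) {σ : BinaryRees k d b}
    (hσ : σ ∉ reesGradedMaximal (binaryMonomialIdeal k d b)) (hdvd : x k d b ^ p ∣ σ * mono h) :
    (MvPolynomial.X 0 ^ i * MvPolynomial.X 1 ^ j : MvPolynomial (Fin 2) k) ∈
      binaryMonomialIdeal k d b ^ n := by
  rw [x, ← map_pow] at hdvd
  obtain ⟨q, hq, heq⟩ := algebraMap_dvd_iff.1 hdvd n
  rw [MulMemClass.coe_mul, coe_mono, ← map_pow, ← map_pow, ← map_mul, mul_left_comm,
    Polynomial.coeff_C_mul, Polynomial.coeff_mul_X_pow', if_pos le_rfl, Nat.sub_self, pow_add,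
    mul_assoc, mul_assoc] at heq
  rw [mem_reesGradedMaximal] at hσ
  refine mem_pow_of_mul_mem_pow hb hσ ?_
  rwa [mul_comm, mul_assoc, ← mul_left_cancel₀ (pow_ne_zero p (MvPolynomial.X_ne_zero 0)) heq]

theorem x_pow_dvd_mul_mono {p n i j m a c : ℕ}
    (h : (MvPolynomial.X 0 ^ (p + i) * MvPolynomial.X 1 ^ j : MvPolynomial (Fin 2) k) ∈
      binaryMonomialIdeal k d b ^ n) {q : BinaryRees k d b}
    (hq : (q : Polynomial (MvPolynomial (Fin 2) k)) =
      Polynomial.C (MvPolynomial.X 0) ^ a * Polynomial.C (MvPolynomial.X 1) ^ c * Polynomial.X ^ m)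
    (hmem : (MvPolynomial.X 0 ^ (a + i) * MvPolynomial.X 1 ^ (c + j) : MvPolynomial (Fin 2) k) ∈
      binaryMonomialIdeal k d b ^ (m + n)) :
    x k d b ^ p ∣ q * mono h := by
  refine ⟨mono hmem, Subtype.ext ?_⟩
  simp only [MulMemClass.coe_mul, SubmonoidClass.coe_pow, coe_x, coe_mono, hq]
  ring

theorem exists_dvd_mul_and_not_dvd_mul (hb : b + 2 ≤ d) (hcop : d.Coprime (d - b)) :
    ∃ f g : BinaryRees k d b, f ≠ 0 ∧
      (∀ q ∈ ({x k d b, y k d b, v k d b, w k d b} : Set (BinaryRees k d b)), f ∣ q * g) ∧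
      ∀ σ ∉ reesGradedMaximal (binaryMonomialIdeal k d b), ¬ f ∣ σ * g := by
  obtain ⟨F, s, hs, hsF, hgap, hlarge⟩ := exists_gap_closure_pair hcop (by omega) (by omega)
  obtain ⟨n, hn⟩ : ∃ n, n = F + d := ⟨_, rfl⟩
  obtain ⟨i, hi⟩ : ∃ i, d * n = s + 1 + i := Nat.exists_eq_add_of_le <| by
    have : n ≤ d * n := Nat.le_mul_of_pos_left n (by omega)
    omega
  have mem_pow {m i j t : ℕ} (ht : t ∈ AddSubmonoid.closure {d, d - b}) (hj : j ≤ m) (htj : t ≤ j)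
      (hit : d * m ≤ i + t) : (MvPolynomial.X 0 ^ i * MvPolynomial.X 1 ^ j :
        MvPolynomial (Fin 2) k) ∈ binaryMonomialIdeal k d b ^ m :=
    (X_pow_mul_X_pow_mem_pow_iff_exists_mem_closure (by omega) hj).2 ⟨t, ht, htj, hit⟩
  have hg :=
    mem_pow (m := n) (i := s + 1 + i) (j := F) (zero_mem _) (by omega) (by omega) (by omega)
  refine ⟨x k d b ^ (s + 1), mono hg, pow_ne_zero _ x_ne_zero, ?_, fun σ hσ hdvd => ?_⟩
  · rintro q (rfl | rfl | rfl | rfl)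
    · exact x_pow_dvd_mul_mono (m := 0) (a := 1) (c := 0) hg (by simp [coe_x])
        (mem_pow hs (by omega) (by omega) (by rw [Nat.zero_add]; omega))
    · exact x_pow_dvd_mul_mono (m := 0) (a := 0) (c := 1) hg (by simp [coe_y])
        (mem_pow (hlarge (1 + F) (by omega)) (by omega) le_rfl (by rw [Nat.zero_add]; omega))
    · exact x_pow_dvd_mul_mono (m := 1) (a := b) (c := d - b) hg (by rw [coe_v, pow_one])
        (mem_pow (hlarge (d - b + F) (by omega)) (by omega) le_rfl (by rw [mul_add]; omega))
    · exact x_pow_dvd_mul_mono (m := 1) (a := 0) hg (by rw [coe_w, pow_zero, one_mul, pow_one])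
        (mem_pow (hlarge (d + F) (by omega)) (by omega) le_rfl (by rw [mul_add]; omega))
  · obtain ⟨t, ht, htF, hit⟩ := (X_pow_mul_X_pow_mem_pow_iff_exists_mem_closure (by omega)
      (by omega)).1 (mem_pow_of_x_pow_dvd_mul_mono (by omega) hg hσ hdvd)
    have : t ≤ s := hgap t ht htF
    omega

theorem not_isCohenMacaulay (hb : b + 2 ≤ d) (hcop : d.Coprime (d - b)) :
    ¬ IsCohenMacaulay (BinaryRees k d b) := by
  intro hCM
  let M := reesGradedMaximal (binaryMonomialIdeal k d b)
  have hbot : binaryMonomialIdeal k d b ≠ ⊥ := (Submodule.ne_bot_iff _).2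
    ⟨MvPolynomial.X 0 ^ d, Ideal.subset_span (by simp), pow_ne_zero d (MvPolynomial.X_ne_zero 0)⟩
  have hdepth : 3 ≤ depthOn (A := Localization.AtPrime M) (IsLocalRing.maximalIdeal _) := by
    rw [← WithBot.coe_le_coe, (hCM.2 M).2, IsLocalization.AtPrime.ringKrullDim_eq_height M,
      WithBot.coe_le_coe]
    exact three_le_height_reesGradedMaximal hbot
  obtain ⟨f, g, hf, hdvd, hnot⟩ := exists_dvd_mul_and_not_dvd_mul (k := k) hb hcop
  obtain ⟨σ, hσ, h⟩ := exists_notMem_dvd_mul_of_two_lt_depthOn reesGradedMaximal_eq_span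
    (lt_of_lt_of_le (by norm_num) hdepth) hf hdvd
  exact hnot σ hσ h

end NotCohenMacaulay

end BinaryRees

section FiniteFlat

open Polynomial

theorem isWeaklyRegular_append_monic {S : Type*} [CommRing S] {rs : List S}
    (h : IsWeaklyRegular S rs) {f : S[X]} (hf : f.Monic) :
    IsWeaklyRegular S[X] (rs.map C ++ [f]) := by
  rw [isWeaklyRegular_append_iff, isWeaklyRegular_singleton_iff]
  refine ⟨h.of_flat, ?_⟩
  rw [isSMulRegular_on_quot_iff_lsmul_comap_le, smul_eq_mul, Ideal.mul_top]
  intro g hg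
  have hfg : f * g ∈ Ideal.ofList (rs.map C) := hg
  rw [← Ideal.map_ofList, ← Ideal.mk_ker (I := Ideal.ofList rs), ← Polynomial.ker_mapRingHom,
    RingHom.mem_ker] at hfg ⊢
  rw [map_mul] at hfg
  exact (hf.map _).mul_right_eq_zero_iff.1 hfg

theorem ringKrullDim_le_of_isIntegral {S A : Type*} [CommRing S] [CommRing A]
    [Algebra S A] [Algebra.IsIntegral S A] : ringKrullDim A ≤ ringKrullDim S :=
  Order.krullDim_le_of_strictMono (PrimeSpectrum.comap (algebraMap S A)) fun _ _ h =>
    Ideal.IsIntegral.comap_lt_comap h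

theorem exists_monic_mem_of_isMaximal {S : Type*} [CommRing S] [IsJacobsonRing S] (p : Ideal S[X])
    [p.IsMaximal] : ∃ f ∈ p, f.Monic := by
  obtain ⟨f, hf, h⟩ := quotient_mk_comp_C_isIntegral_of_isJacobsonRing p (Ideal.Quotient.mk p X)
  rw [← hom_eval₂, eval₂_C_X] at h
  exact ⟨f, Ideal.Quotient.eq_zero_iff_mem.1 h, hf⟩

/-- Every maximal ideal of `S` contains a weakly regular sequence of length `n`: a lower bound on
the depths of the localizations of `S` that passes to polynomial rings and finite flat algebras. -/
def HasRegularSequences (S : Type*) [CommRing S] (n : ℕ) : Prop :=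
  ∀ p : Ideal S, p.IsMaximal →
    ∃ rs : List S, (∀ r ∈ rs, r ∈ p) ∧ IsWeaklyRegular S rs ∧ rs.length = n

namespace HasRegularSequences

theorem zero (S : Type*) [CommRing S] : HasRegularSequences S 0 :=
  fun _ _ => ⟨[], by simp, IsWeaklyRegular.nil _ _, rfl⟩

theorem polynomial {S : Type*} [CommRing S] [IsJacobsonRing S] {n : ℕ}
    (h : HasRegularSequences S n) : HasRegularSequences S[X] (n + 1) := by
  intro p hp
  obtain ⟨rs, hrs, hreg, hlen⟩ := h _ (isMaximal_comap_C_of_isJacobsonRing p)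
  obtain ⟨f, hfp, hf⟩ := exists_monic_mem_of_isMaximal p
  refine ⟨rs.map C ++ [f], ?_, isWeaklyRegular_append_monic hreg hf, by simp [hlen]⟩
  simp only [List.mem_append, List.mem_map, List.mem_singleton]
  rintro _ (⟨s, hs, rfl⟩ | rfl)
  · exact hrs s hs
  · exact hfp

variable {S A : Type*} [CommRing S] [CommRing A] [Algebra S A] [Module.Finite S A] {n : ℕ}

theorem le_depthOn_localization [Module.Flat S A] (h : HasRegularSequences S n) (P : Ideal A)
    [P.IsMaximal] :
    (n : ℕ∞) ≤ depthOn (A := Localization.AtPrime P) (IsLocalRing.maximalIdeal _) := by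
  obtain ⟨rs, hrs, hreg, rfl⟩ := h (P.comap (algebraMap S A))
    (Ideal.isMaximal_comap_of_isIntegral_of_isMaximal P)
  have hA : IsWeaklyRegular A (rs.map (algebraMap S A)) := hreg.of_flat
  have hmem : ∀ r ∈ rs.map (algebraMap S A), r ∈ P := List.forall_mem_map.2 hrs
  have hloc := hA.isRegular_of_isLocalization_of_mem (Localization.AtPrime P) P hmem
  have hmem' : ∀ r ∈ (rs.map (algebraMap S A)).map (algebraMap A (Localization.AtPrime P)),
      r ∈ IsLocalRing.maximalIdeal (Localization.AtPrime P) := List.forall_mem_map.2 fun r hr =>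
    (IsLocalization.AtPrime.to_map_mem_maximal_iff _ P r).2 (hmem r hr)
  simpa using le_depthOn hmem' hloc

theorem isCohenMacaulay [IsNoetherianRing S] [Module.Flat S A] (h : HasRegularSequences S n)
    (hdim : ringKrullDim S ≤ n) : IsCohenMacaulay A := by
  have hnoeth : IsNoetherianRing A := IsNoetherianRing.of_finite S A
  refine ⟨hnoeth, fun P _ => ⟨inferInstance, le_antisymm depthOn_maximalIdeal_le_ringKrullDim ?_⟩⟩
  calc ringKrullDim (Localization.AtPrime P) = P.height :=
        IsLocalization.AtPrime.ringKrullDim_eq_height P _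
    _ ≤ ringKrullDim A := Ideal.height_le_ringKrullDim_of_isPrime
    _ ≤ ringKrullDim S := ringKrullDim_le_of_isIntegral
    _ ≤ n := hdim
    _ ≤ _ := by exact_mod_cast h.le_depthOn_localization P

end HasRegularSequences

theorem span_eq_top_of_adjoin_eq_top {S A : Type*} [CommRing S] [CommRing A] [Algebra S A]
    {s t : Set A} (hs : Algebra.adjoin S s = ⊤) (h_one : 1 ∈ Submodule.span S t)
    (hmul : ∀ a ∈ s, ∀ b ∈ t, a * b ∈ Submodule.span S t) : Submodule.span S t = ⊤ := by
  refine Submodule.eq_top_iff'.2 fun a => ?_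
  suffices h : ∀ b ∈ Submodule.span S t, a * b ∈ Submodule.span S t from mul_one a ▸ h 1 h_one
  have ha : a ∈ Algebra.adjoin S s := hs ▸ Algebra.mem_top
  induction ha using Algebra.adjoin_induction with
  | mem a ha =>
    exact Submodule.span_le (p := (Submodule.span S t).comap (LinearMap.mulLeft S a)).2 (hmul a ha)
  | algebraMap r => exact fun b hb => Algebra.smul_def r b ▸ Submodule.smul_mem _ r hb
  | add a a' _ _ h h' => exact fun b hb => add_mul a a' b ▸ add_mem (h b hb) (h' b hb)
  | mul a a' _ _ h h' => exact fun b hb => mul_assoc a a' b ▸ h _ (h' b hb)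

theorem compRingHom_injective {D : Type*} [CommRing D] [IsDomain D] {q : D[X]}
    (hq : q.natDegree ≠ 0) : Function.Injective (compRingHom q) :=
  (injective_iff_map_eq_zero _).2 fun _ hp =>
    (comp_eq_zero_iff.1 hp).resolve_right fun hC => hq (hC.2 ▸ natDegree_C _)

theorem eq_zero_of_sum_comp_mul_eq_zero {D : Type*} [CommRing D] [IsDomain D] {n : ℕ} {q : D[X]}
    (hq : q.natDegree = n) {b p : Fin n → D[X]} (hb : ∀ i, b i ≠ 0)
    (hdeg : ∀ i, (b i).natDegree = i) (h : ∑ i, (p i).comp q * b i = 0) (i : Fin n) : p i = 0 := by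
  have hterm (i : Fin n) (hi : (p i).comp q * b i ≠ 0) :
      ((p i).comp q * b i).natDegree = n * (p i).natDegree + i := by
    rw [natDegree_mul (left_ne_zero_of_mul hi) (hb i), natDegree_comp, hq, hdeg, mul_comm]
  have hsup := degree_sum_eq_of_disjoint (fun i => (p i).comp q * b i) Finset.univ <| by
    intro i hi j hj hij heq
    have hnat := natDegree_eq_of_degree_eq heq
    rw [hterm i hi.2, hterm j hj.2] at hnat
    have hmod := congrArg (· % n) hnat
    simp only [Nat.mul_add_mod, Nat.mod_eq_of_lt i.2, Nat.mod_eq_of_lt j.2] at hmod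
    exact hij (Fin.ext hmod)
  rw [h, degree_zero, eq_comm, Finset.sup_eq_bot_iff] at hsup
  have hcomp : (p i).comp q = 0 :=
    (mul_eq_zero.1 (degree_eq_bot.1 (hsup i (Finset.mem_univ i)))).resolve_right (hb i)
  exact (injective_iff_map_eq_zero _).1 (compRingHom_injective (by have := i.2; omega)) _ hcomp

end FiniteFlat

namespace BinaryRees

section Veronese

open Polynomial

-- Unifying the ring structures on `k[X][X][X]` nests instance problems three deep.
set_option maxSynthPendingDepth 3

variable {k : Type*} [Field k]

/-- The system of parameters `y, y²T - x, x²T` of the Rees algebra of `(x², y², xy)`, as the images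
of the variables of an iterated polynomial ring, the innermost first. -/
noncomputable def parameters (k : Type*) [Field k] : k[X][X][X] →+* BinaryRees k 2 1 :=
  eval₂RingHom (eval₂RingHom (aeval (y k 2 1)).toRingHom (w k 2 1 - x k 2 1)) (u k 2 1)

theorem parameters_C_C_X : parameters k (C (C X)) = y k 2 1 := by
  simp [parameters]

theorem parameters_C_X : parameters k (C X) = w k 2 1 - x k 2 1 := by
  simp [parameters]

theorem parameters_X : parameters k X = u k 2 1 := by
  simp [parameters]

theorem parameters_C_C_C (r : k) :
    parameters k (C (C (C r))) = algebraMap k (BinaryRees k 2 1) r := by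
  simp [parameters]

/-- The structure of algebra over the polynomial ring in the parameters. -/
noncomputable abbrev parametersAlgebra : Algebra k[X][X][X] (BinaryRees k 2 1) :=
  (parameters k).toAlgebra

attribute [local instance] parametersAlgebra

theorem x_mul_w : x k 2 1 * w k 2 1 = y k 2 1 * v k 2 1 := by
  refine Subtype.ext ?_
  simp only [MulMemClass.coe_mul, coe_x, coe_y, coe_v, coe_w]
  ring

theorem x_mul_v : x k 2 1 * v k 2 1 = u k 2 1 * y k 2 1 := by
  refine Subtype.ext ?_
  simp only [MulMemClass.coe_mul, coe_x, coe_y, coe_v, coe_u]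
  ring

theorem v_mul_v : v k 2 1 * v k 2 1 = u k 2 1 * w k 2 1 := by
  refine Subtype.ext ?_
  simp only [MulMemClass.coe_mul, coe_v, coe_w, coe_u]
  ring

theorem adjoin_x_v_eq_top : Algebra.adjoin k[X][X][X] {x k 2 1, v k 2 1} = ⊤ := by
  have : IsScalarTower k k[X][X][X] (BinaryRees k 2 1) :=
    .of_algebraMap_eq fun r => (parameters_C_C_C r).symm
  have hparam (p : k[X][X][X]) : parameters k p ∈ Algebra.adjoin k[X][X][X] {x k 2 1, v k 2 1} :=
    Subalgebra.algebraMap_mem _ p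
  have hx : x k 2 1 ∈ Algebra.adjoin k[X][X][X] {x k 2 1, v k 2 1} :=
    Algebra.subset_adjoin (by simp)
  have hy : y k 2 1 ∈ Algebra.adjoin k[X][X][X] {x k 2 1, v k 2 1} :=
    parameters_C_C_X (k := k) ▸ hparam _
  have hu : u k 2 1 ∈ Algebra.adjoin k[X][X][X] {x k 2 1, v k 2 1} :=
    parameters_X (k := k) ▸ hparam _
  have hw : w k 2 1 ∈ Algebra.adjoin k[X][X][X] {x k 2 1, v k 2 1} := by
    simpa only [parameters_C_X, sub_add_cancel] using add_mem (hparam (C X)) hx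
  have hv : v k 2 1 ∈ Algebra.adjoin k[X][X][X] {x k 2 1, v k 2 1} :=
    Algebra.subset_adjoin (by simp)
  have htop : Algebra.adjoin k {x k 2 1, y k 2 1, u k 2 1, w k 2 1, v k 2 1} ≤
      Subalgebra.restrictScalars k (Algebra.adjoin k[X][X][X] {x k 2 1, v k 2 1}) :=
    Algebra.adjoin_le <| by rintro _ (rfl | rfl | rfl | rfl | rfl); exacts [hx, hy, hu, hw, hv]
  rw [adjoin_generators_eq_top, top_le_iff] at htop
  refine Subalgebra.restrictScalars_injective k ?_
  rw [htop, Subalgebra.restrictScalars_top]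

theorem span_one_x_v_eq_top : Submodule.span k[X][X][X] {1, x k 2 1, v k 2 1} = ⊤ := by
  have mem (p q r : k[X][X][X]) :
      parameters k p + parameters k q * x k 2 1 + parameters k r * v k 2 1 ∈
        Submodule.span k[X][X][X] {1, x k 2 1, v k 2 1} :=
    Submodule.mem_span_triple.2 ⟨p, q, r, by
      simp only [Algebra.smul_def, RingHom.algebraMap_toAlgebra, mul_one]⟩
  have hxx : x k 2 1 * x k 2 1 ∈ Submodule.span k[X][X][X] {1, x k 2 1, v k 2 1} := by
    convert mem 0 (-(C X : k[X][X][X])) (C (C X)) using 1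
    rw [map_zero, map_neg, parameters_C_X, parameters_C_C_X]
    linear_combination x_mul_w (k := k)
  have hxv : x k 2 1 * v k 2 1 ∈ Submodule.span k[X][X][X] {1, x k 2 1, v k 2 1} := by
    convert mem (X * C (C X)) 0 0 using 1
    rw [map_zero, map_mul, parameters_X, parameters_C_C_X]
    linear_combination x_mul_v (k := k)
  have hvv : v k 2 1 * v k 2 1 ∈ Submodule.span k[X][X][X] {1, x k 2 1, v k 2 1} := by
    convert mem (X * C X) X 0 using 1
    rw [map_zero, map_mul, parameters_X, parameters_C_X]
    linear_combination v_mul_v (k := k)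
  have hx : x k 2 1 ∈ Submodule.span k[X][X][X] {1, x k 2 1, v k 2 1} :=
    Submodule.subset_span (by simp)
  have hv : v k 2 1 ∈ Submodule.span k[X][X][X] {1, x k 2 1, v k 2 1} :=
    Submodule.subset_span (by simp)
  refine span_eq_top_of_adjoin_eq_top adjoin_x_v_eq_top (Submodule.subset_span (by simp)) ?_
  rintro _ (rfl | rfl) _ (rfl | rfl | rfl)
  exacts [(mul_one (x k 2 1)).symm ▸ hx, hxx, hxv, (mul_one (v k 2 1)).symm ▸ hv,
    mul_comm (x k 2 1) (v k 2 1) ▸ hxv, hvv]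

/-- The substitution `x ↦ c²ξ`, `y ↦ c`, `T ↦ ξ + α`, with values in the polynomials in `ξ` over
`k[c][α]`; it is chosen so that `y²T - x ↦ c²α` does not involve `ξ`. -/
noncomputable def specialize (k : Type*) [Field k] : (MvPolynomial (Fin 2) k)[X] →+* k[X][X][X] :=
  eval₂RingHom (MvPolynomial.aeval ![(C (C X ^ 2) * X : k[X][X][X]), C (C X)]).toRingHom
    (X + C X)

theorem specialize_C_X_zero : specialize k (C (MvPolynomial.X 0)) = C (C X ^ 2) * X := by
  simp [specialize]

theorem specialize_C_X_one : specialize k (C (MvPolynomial.X 1)) = C (C X) := by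
  simp [specialize]

theorem specialize_X : specialize k X = X + C X := by
  simp [specialize]

theorem specialize_u : specialize k (u k 2 1) = C (C X ^ 4) * (X ^ 2 * (X + C X)) := by
  rw [coe_u, map_mul, map_pow, specialize_C_X_zero, specialize_X]
  simp only [map_pow]
  ring

theorem specialize_v : specialize k (v k 2 1) = C (C X ^ 3) * (X * (X + C X)) := by
  rw [coe_v, map_mul, map_mul, map_pow, map_pow, specialize_C_X_zero, specialize_C_X_one,
    specialize_X]
  simp only [map_pow]
  ring

theorem specialize_w_sub_x :
    specialize k (w k 2 1 - x k 2 1 : BinaryRees k 2 1) = C (C X ^ 2 * X) := by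
  rw [AddSubgroupClass.coe_sub, map_sub, coe_w, coe_x, map_mul, map_pow, specialize_C_X_zero,
    specialize_C_X_one, specialize_X]
  simp only [map_pow, map_mul]
  ring

theorem specialize_parameters (p : k[X][X][X]) : specialize k (parameters k p) =
    (p.map (compRingHom (C X ^ 2 * X))).comp (C (C X ^ 4) * (X ^ 2 * (X + C X))) := by
  suffices h : ((specialize k).comp (Subalgebra.val _).toRingHom).comp (parameters k) =
      (compRingHom (C (C X ^ 4) * (X ^ 2 * (X + C X)))).comp
        (mapRingHom (compRingHom (C X ^ 2 * X))) from DFunLike.congr_fun h p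
  refine ringHom_ext' (ringHom_ext' (ringHom_ext' (RingHom.ext fun r => ?_) ?_) ?_) ?_
  · simp [specialize, parameters_C_C_C]
  · simpa [parameters_C_C_X, coe_y] using specialize_C_X_one
  · simpa [parameters_C_X] using specialize_w_sub_x
  · simpa [parameters_X] using specialize_u

theorem linearIndependent_one_x_v : LinearIndependent k[X][X][X] ![1, x k 2 1, v k 2 1] := by
  have hX : (X : k[X][X][X]).Monic := monic_X
  have hT : (X + C X : k[X][X][X]).Monic := monic_X_add_C X
  have hc (n : ℕ) : (C X ^ n : k[X][X]) ≠ 0 := pow_ne_zero n (C_ne_zero.2 X_ne_zero)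
  have hσ : Function.Injective (compRingHom (C X ^ 2 * X : k[X][X])) :=
    compRingHom_injective (by simp [← C_pow, -map_pow])
  have hu : (C (C X ^ 4) * (X ^ 2 * (X + C X)) : k[X][X][X]).natDegree = 3 := by
    rw [natDegree_C_mul (hc 4), (hX.pow 2).natDegree_mul hT, natDegree_X_pow, natDegree_X_add_C]
  have hx : (specialize k (x k 2 1)).natDegree = 1 := by
    rw [coe_x, specialize_C_X_zero, natDegree_C_mul (hc 2), natDegree_X]
  have hv : (specialize k (v k 2 1)).natDegree = 2 := by
    rw [specialize_v, natDegree_C_mul (hc 3), hX.natDegree_mul hT, natDegree_X, natDegree_X_add_C]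
  refine Fintype.linearIndependent_iff.2 fun p hp i => (Polynomial.map_eq_zero_iff hσ).1 ?_
  refine eq_zero_of_sum_comp_mul_eq_zero hu (p := fun i => (p i).map _)
    (b := ![1, specialize k (x k 2 1), specialize k (v k 2 1)]) ?_ ?_ ?_ i
  · have hx₀ := ne_zero_of_natDegree_gt (hx.symm ▸ one_pos)
    have hv₀ := ne_zero_of_natDegree_gt (hv.symm ▸ two_pos)
    simp [Fin.forall_fin_succ, hx₀, hv₀]
  · simp [Fin.forall_fin_succ, hx, hv]
  · have hspec := congrArg (fun a : BinaryRees k 2 1 => specialize k a) hp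
    simpa [Fin.sum_univ_three, Algebra.smul_def, RingHom.algebraMap_toAlgebra,
      specialize_parameters] using hspec

theorem isCohenMacaulay_two : IsCohenMacaulay (BinaryRees k 2 1) := by
  let basis := Module.Basis.mk (linearIndependent_one_x_v (k := k)) <| by
    simp only [Matrix.range_cons, Matrix.range_empty, Set.union_empty]
    exact span_one_x_v_eq_top.ge
  have : Module.Free k[X][X][X] (BinaryRees k 2 1) := .of_basis basis
  have : Module.Finite k[X][X][X] (BinaryRees k 2 1) := .of_basis basis
  have hdim : ringKrullDim k[X][X][X] ≤ (3 : ℕ) := by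
    simp only [Polynomial.ringKrullDim_of_isNoetherianRing, ringKrullDim_eq_zero_of_field]
    norm_num
  exact ((HasRegularSequences.zero k).polynomial.polynomial.polynomial).isCohenMacaulay hdim

end Veronese

end BinaryRees

theorem theorem2p6 {k : Type*} [Field k] (d b : ℕ) (hd : 2 ≤ d) (hb : b ≤ d - b)
    (hgcd : Nat.gcd d b = 1) :
    IsAlmostCohenMacaulayRees (binaryMonomialIdeal k d b) ∧
      (IsCohenMacaulay (reesAlgebra (binaryMonomialIdeal k d b)) ↔ d = 2) := by
  refine ⟨BinaryRees.isAlmostCohenMacaulayRees (by omega), fun hCM => ?_, ?_⟩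
  · by_contra hne
    have hcop : d.Coprime (d - b) := (Nat.coprime_self_sub_right (by omega)).2 hgcd
    exact BinaryRees.not_isCohenMacaulay (by omega) hcop hCM
  · rintro rfl
    obtain rfl : b = 1 := by
      obtain rfl | h : b = 0 ∨ b = 1 := by omega
      · simp at hgcd
      · exact h
    exact BinaryRees.isCohenMacaulay_two
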